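/- Let $\mathfrak H_a=\mathrm{span}_{\mathbb C}\{|k\rangle : k=0,1,2,\dots\}$ and, for $p\in\mathbb C$, let $$A_0(p)=\sum_{k\ge 0}(p-k)\,|k\rangle\langle k|,\qquad A_+(p)=\sum_{k\ge 0}(k-2p)\,|k\rangle\langle k+1|,\qquad A_-=\sum_{k\ge 0}(k+1)\,|k+1\rangle\langle k| .$$ On a chain of $n$ spins with space $(\mathbb C^2)^{\otimes n}$, let $\sigma^0=1$, $\sigma^+=\begin{pmatrix}0&1\\0&0\end{pmatrix}$, $\sigma^-=\begin{pmatrix}0&0\\1&0\end{pmatrix}$, with a subscript $k$ for the action on site $k$, and define the Lax operators $$L_k(p)=\sigma_k^0\otimes A_0(p)+\sigma_k^+\otimes A_+(p)+\sigma_k^-\otimes A_-,\qquad 1\le k\le n,$$ and the transfer operator $S(p)=\langle 0|L_1(p)L_2(p)\cdots L_n(p)|0\rangle\in\mathrm{End}((\mathbb C^2)^{\otimes n})$. With two copies of $\mathfrak H_a$, write $L_{a_1k}(p)$ and $L_{a_2k}(p)$ for $L_k(p)$ acting in the first and in the second copy. For $x\in\mathbb C\setminus\frac12\mathbb Z_{\ge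 0}$ let $f_m(x)=(x-m/2)^{-1}$ and let $H(x)=\bigoplus_{\alpha\ge 0}H^{(\alpha)}(x)$ be the operator on $\mathfrak H_a\otimes\mathfrak H_a$ that is block diagonal over the sectors $\mathrm{span}\{|k,\alpha-k\rangle : 0\le k\le\alpha\}$, that is, $H(x)=\sum_{\alpha}\sum_{k,l=0}^{\alpha}H^{(\alpha)}_{k,l}(x)\,|k,\alpha-k\rangle\langle l,\alpha-l|$, with $$H^{(\alpha)}_{k,l}(x)=\frac{(-1)^{k-l-1}}{2}\binom kl\sum_{m=l}^{k-1}(-1)^{m-l}\binom{k-l-1}{m-l}f_m(x)\quad(k\ge l+1),$$ $$H^{(\alpha)}_{k,k}(x)=-\frac12\sum_{m=k}^{\alpha-k-1}f_m(x)\quad(2k\le\alpha),\qquad H^{(\alpha)}_{\alpha-k,\alpha-l}(x)=-H^{(\alpha)}_{k,l}(x).$$ Then for all $x\in\mathbb C\setminus\frac12\mathbb Z_{\ge 0}$ and all $y\in\mathbb C$ the operator $$\check R\left(x+\tfrac y2,\,x-\tfrac y2\right)=\exp\big(y\,H(x)\big)$$ (the exponential is taken block by block), with $p=x+\frac y2$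 and $p'=x-\frac y2$, satisfies the RLL relation $$\check R(p,p')\,L_{a_1k}(p)\,L_{a_2k}(p')=L_{a_1k}(p')\,L_{a_2k}(p)\,\check R(p,p')$$ for every chain length $n$ and every site $k$, and it fixes the product vacuum: $\check R(p,p')|0,0\rangle=|0,0\rangle$ and $\langle 0,0|\check R(p,p')=\langle 0,0|$. Moreover, for every $n$ and all $p,p'\in\mathbb C$, $$[S(p),S(p')]=0 .$$ -/

import Mathlib

open scoped TensorProduct

noncomputable section

namespace ExteriorIntegrability

/-! ### The auxiliary space and its tridiagonal operators -/

/-- The auxiliary space: the complex linear span of kets `|0⟩, |1⟩, |2⟩, …`. -/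
abbrev Aux : Type := ℕ →₀ ℂ

/-- The basis vector `|k⟩`. -/
def ket (k : ℕ) : Aux := Finsupp.single k 1

/-- The amplitude `a⁰_k(p) = p - k`. -/
def ampZero (p : ℂ) (k : ℕ) : ℂ := p - k

/-- The amplitude `a⁺_k(p) = k - 2p`. -/
def ampPlus (p : ℂ) (k : ℕ) : ℂ := k - 2 * p

/-- The amplitude `a⁻_k = k + 1`. -/
def ampMinus (k : ℕ) : ℂ := k + 1

/-- `A₀(p) = ∑ₖ a⁰_k(p) |k⟩⟨k|`. -/
def opZero (p : ℂ) : Module.End ℂ Aux :=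
  Finsupp.linearCombination ℂ fun k => ampZero p k • ket k

/-- `A₊(p) = ∑ₖ a⁺_k(p) |k⟩⟨k+1|`. -/
def opPlus (p : ℂ) : Module.End ℂ Aux :=
  Finsupp.linearCombination ℂ fun j =>
    match j with
    | 0 => 0
    | k + 1 => ampPlus p k • ket k

/-- `A₋ = ∑ₖ a⁻_k |k+1⟩⟨k|`. -/
def opMinus : Module.End ℂ Aux :=
  Finsupp.linearCombination ℂ fun k => ampMinus k • ket (k + 1)

/-! ### The spin chain and the Lax operator -/

/-- `σ⁰`, the identity. -/
def sigmaZero : Matrix (Fin 2) (Fin 2) ℂ := 1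

/-- `σ⁺ = (σˣ + iσʸ)/2`. -/
def sigmaPlus : Matrix (Fin 2) (Fin 2) ℂ := !![0, 1; 0, 0]

/-- `σ⁻ = (σˣ - iσʸ)/2`. -/
def sigmaMinus : Matrix (Fin 2) (Fin 2) ℂ := !![0, 0; 1, 0]

/-- The `n`-site chain `(ℂ²)^{⊗n}` is represented by its computational basis `|ν₁,…,νₙ⟩`,
`ν_j ∈ {0, 1}`; operators on it are matrices indexed by `Config n`. -/
abbrev Config (n : ℕ) : Type := Fin n → Fin 2

/-- The one-site operator `M` acting on site `k` of the chain and as the identity elsewhere. -/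
def atSite {n : ℕ} (k : Fin n) (M : Matrix (Fin 2) (Fin 2) ℂ) :
    Matrix (Config n) (Config n) ℂ :=
  Matrix.of fun ν ν' => if ∀ j, j ≠ k → ν j = ν' j then M (ν k) (ν' k) else 0

/-- `M ⊗ A`, an operator on (spins) ⊗ (auxiliary space), written as a matrix in the spin basis
whose entries are operators on the auxiliary space. -/
def opTensor {ι V : Type*} [AddCommMonoid V] [Module ℂ V]
    (M : Matrix ι ι ℂ) (A : Module.End ℂ V) : Matrix ι ι (Module.End ℂ V) :=
  M.map fun c => c • A

/-- The Lax operator `L_k(p) = σ⁰_k ⊗ A₀(p) + σ⁺_k ⊗ A₊(p) + σ⁻_k ⊗ A₋`. -/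
def lax {n : ℕ} (k : Fin n) (p : ℂ) : Matrix (Config n) (Config n) (Module.End ℂ Aux) :=
  opTensor (atSite k sigmaZero) (opZero p) + opTensor (atSite k sigmaPlus) (opPlus p)
    + opTensor (atSite k sigmaMinus) opMinus

/-- The monodromy matrix `T(p) = L₁(p) L₂(p) ⋯ Lₙ(p)`. -/
def monodromy (n : ℕ) (p : ℂ) : Matrix (Config n) (Config n) (Module.End ℂ Aux) :=
  (List.ofFn fun k : Fin n => lax k p).prod

/-- The vacuum-contracted transfer operator `S(p) = ⟨0|T(p)|0⟩`. -/
def transfer (n : ℕ) (p : ℂ) : Matrix (Config n) (Config n) ℂ :=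
  (monodromy n p).map fun A => A (ket 0) 0

/-! ### Two copies of the auxiliary space -/

/-- `L_{a₁k}(p)`, the Lax operator acting in the first of two auxiliary spaces. -/
def laxFst {n : ℕ} (k : Fin n) (p : ℂ) :
    Matrix (Config n) (Config n) (Module.End ℂ (Aux ⊗[ℂ] Aux)) :=
  (lax k p).map fun A => TensorProduct.map A LinearMap.id

/-- `L_{a₂k}(p)`, the Lax operator acting in the second of two auxiliary spaces. -/
def laxSnd {n : ℕ} (k : Fin n) (p : ℂ) :
    Matrix (Config n) (Config n) (Module.End ℂ (Aux ⊗[ℂ] Aux)) :=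
  (lax k p).map fun A => TensorProduct.map LinearMap.id A

/-- An operator on the two auxiliary spaces, acting as the identity on the spins. -/
def onAux {n : ℕ} (R : Module.End ℂ (Aux ⊗[ℂ] Aux)) :
    Matrix (Config n) (Config n) (Module.End ℂ (Aux ⊗[ℂ] Aux)) :=
  opTensor 1 R

/-- The basis `|k, l⟩ = |k⟩ ⊗ |l⟩` of the product of the two auxiliary spaces. -/
def ketBasis : Module.Basis (ℕ × ℕ) ℂ (Aux ⊗[ℂ] Aux) :=
  Finsupp.basisSingleOne.tensorProduct Finsupp.basisSingleOne

/-- The block-diagonal operator `⨁_α X^{(α)} = ∑_α ∑_{k,l ≤ α} X^{(α)}_{k,l} |k,α-k⟩⟨l,α-l|`. -/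
def blockSum (X : ∀ α : ℕ, Matrix (Fin (α + 1)) (Fin (α + 1)) ℂ) :
    Module.End ℂ (Aux ⊗[ℂ] Aux) :=
  ketBasis.constr ℂ fun b =>
    ∑ k : Fin (b.1 + b.2 + 1),
      X (b.1 + b.2) k ⟨b.1, by omega⟩ • ketBasis ((k : ℕ), b.1 + b.2 - (k : ℕ))

/-- `E = exp X` on the product of the two auxiliary spaces: every matrix element of the exponential
series of `X` converges to that of `E`. -/
def IsExpOf (E X : Module.End ℂ (Aux ⊗[ℂ] Aux)) : Prop :=
  ∀ b c : ℕ × ℕ, HasSum (fun j : ℕ => ((j.factorial : ℂ))⁻¹ *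
    ketBasis.coord b ((X ^ j) (ketBasis c))) (ketBasis.coord b (E (ketBasis c)))

/-! ### The generator and the braided exterior R-matrix -/

/-- The simple-pole function `f_m(x) = (x - m/2)⁻¹`. -/
def pole (m : ℕ) (x : ℂ) : ℂ := (x - (m : ℂ) / 2)⁻¹

/-- The matrix element of the generator below the diagonal, `k ≥ l + 1`:
`((-1)^(k-l-1)/2) * C(k,l) * ∑_{m=l}^{k-1} (-1)^(m-l) * C(k-l-1, m-l) * f_m(x)`. -/
def genLower (k l : ℕ) (x : ℂ) : ℂ :=
  (-1) ^ (k - l - 1) / 2 * (k.choose l : ℂ) *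
    ∑ m ∈ Finset.Ico l k, (-1) ^ (m - l) * ((k - l - 1).choose (m - l) : ℂ) * pole m x

/-- The diagonal matrix element of the generator for `2k ≤ α`:
`-(1/2) * ∑_{m=k}^{α-k-1} f_m(x)`. -/
def genDiag (α k : ℕ) (x : ℂ) : ℂ :=
  -(1 / 2) * ∑ m ∈ Finset.Ico k (α - k), pole m x

/-- The block `H^{(α)}(x)`; the elements above the diagonal and those in the lower half of the
diagonal are fixed by the antisymmetry `H_{α-k,α-l} = -H_{k,l}`. -/
def genBlock (α : ℕ) (x : ℂ) : Matrix (Fin (α + 1)) (Fin (α + 1)) ℂ :=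
  Matrix.of fun k l =>
    if l < k then genLower k l x
    else if k < l then -genLower (α - (k : ℕ)) (α - (l : ℕ)) x
    else if 2 * (k : ℕ) ≤ α then genDiag α k x
    else -genDiag α (α - (k : ℕ)) x

/-- The generator `H(x) = ⨁_α H^{(α)}(x)`. -/
def gen (x : ℂ) : Module.End ℂ (Aux ⊗[ℂ] Aux) := blockSum fun α => genBlock α x

/-- The braided exterior R-matrix as a function of `(p, p')`: the exponential of
`(p - p') H((p + p')/2)`, taken block by block. -/
def rMatrix (p p' : ℂ) : Module.End ℂ (Aux ⊗[ℂ] Aux) :=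
  blockSum fun α => NormedSpace.exp ((p - p') • genBlock α ((p + p') / 2))

end ExteriorIntegrability

end

/-!
The generator is a difference of two digamma-like functions. Let `E₁, E₂` be the creation operators
and `T₁, T₂` the annihilation operators of the two auxiliary spaces, normalised by `[T, E] = 1`, and
let `h` be a function with `h (k + 1) - h k = (2 x - k)⁻¹`. The operator `E₁ (T₁ + T₂)` is
triangular with spectrum `ℕ`, so Newton's forward difference formula defines
`Φ₁ = h (E₁ (T₁ + T₂))`, and with its mirror image `Φ₂ = h (E₂ (T₁ + T₂))` one finds
`H(x) = Φ₁ - Φ₂`; the binomial sums in the definition of `H(x)` are iterated differences of `h`.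

The commutators of `Φ₁` with `E₁`, `E₁ - E₂`, `T₂` and `T₁ + T₂` are elementary, and they show that
the triple commutators of `H(x)` with each of the following three operators vanish:
`E₁ - E₂`, the difference `A₊(p) ⊗ 1 - 1 ⊗ A₊(p')`, and the lower left entry of the product
`L(p) L(p')` of the two Lax matrices. For such operators `Z` the expansion
`exp (y H) Z exp (-y H) = ∑ᵢ (y ad H)ⁱ Z / i!` is a finite sum, and it has the effect of replacing
`y` by `-y`, that is, of exchanging `p` and `p'`. The entries of `L(p) L(p')` are generated by these
three operators through commutators and the Casimir elements of the two copies of `sl₂`, whence the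
RLL relation.

Carrying `Ř(p, p')` through the chain site by site, and using that it fixes the product vacuum on
both sides, gives `S(p) S(p') = S(p') S(p)` whenever `p + p'` is not a natural number. The excluded
values of `p'` are countably many and `S` is continuous, so the identity holds everywhere.
-/

noncomputable section

open Finset

namespace ExteriorIntegrability

attribute [local instance] LieRing.ofAssociativeRing

section Bracket

variable {A B : Type*} [Ring A]

theorem lie_mul (a b c : A) : ⁅a, b * c⁆ = ⁅a, b⁆ * c + b * ⁅a, c⁆ := by
  simp only [Ring.lie_def]
  noncomm_ring

theorem mul_lie (a b c : A) : ⁅a * b, c⁆ = ⁅a, c⁆ * b + a * ⁅b, c⁆ := by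
  simp only [Ring.lie_def]
  noncomm_ring

theorem semiconjBy_lie {a b b' c c' : A} (hb : SemiconjBy a b b') (hc : SemiconjBy a c c') :
    SemiconjBy a ⁅b, c⁆ ⁅b', c'⁆ :=
  (hb.mul_right hc).sub_right (hc.mul_right hb)

theorem commute_of_mul_eq_one {a u s : A} (h : Commute a u) (hus : u * s = 1) (hsu : s * u = 1) :
    Commute a s :=
  Commute.units_inv_right (u := ⟨u, s, hus, hsu⟩) h

theorem lie_of_mul_eq_one {u s : A} (hus : u * s = 1) (hsu : s * u = 1) (a : A) :
    ⁅a, s⁆ = -(s * ⁅a, u⁆ * s) := by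
  simp only [Ring.lie_def, mul_sub, sub_mul, ← mul_assoc, hsu, one_mul]
  simp only [mul_assoc, hus, mul_one, neg_sub]

theorem commute_lie_of_commute {a b c : A} (hac : Commute a c) (h : Commute a ⁅b, c⁆) :
    Commute ⁅a, b⁆ c := by
  rw [commute_iff_lie_eq, lie_lie, h.lie_eq, hac.lie_eq, lie_zero, sub_zero]

theorem commute_lie {a b c : A} (hac : Commute a c) (hbc : Commute b c) : Commute ⁅a, b⁆ c :=
  commute_lie_of_commute hac (hbc.lie_eq ▸ Commute.zero_right a)

theorem commute_add_sub_of_lie_eq {a a' b b' : A} (h : ⁅a, b⁆ = ⁅a', b'⁆) (hab : Commute a b')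
    (hba : Commute a' b) : Commute (a + a') (b - b') := by
  rw [commute_iff_lie_eq, add_lie, lie_sub, lie_sub, h, hab.lie_eq, hba.lie_eq, sub_zero, zero_sub,
    add_neg_cancel]

variable {F : Type*} [Ring B] [FunLike F A B] [RingHomClass F A B]

theorem lie_map (f : F) (a b : A) : ⁅f a, f b⁆ = f ⁅a, b⁆ := by
  simp only [Ring.lie_def, map_sub, map_mul]

end Bracket

section Digamma

variable {K A B : Type*} [CommRing K] [Ring A] [Algebra K A] [Ring B] [Algebra K B]

/-- `Φ` is a digamma-like function `h` of the number-like operator `E₁ (T₁ + T₂)` with difference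
`h (k + 1) - h k = (2 x - k)⁻¹`, and `s` is the resolvent `(2 x - E₁ (T₁ + T₂))⁻¹`. With
`E₁, E₂` the creation operators and `T₁, T₂` the annihilation operators of the two auxiliary spaces,
the difference of such a `Φ` and of its mirror image under `1 ↔ 2` is the generator `H(x)`. -/
structure IsDigamma (x : K) (E₁ E₂ T₁ T₂ Φ s : A) : Prop where
  commute_sub : Commute Φ (E₁ - E₂)
  commute_annihilation : Commute Φ T₂
  lie_add : ⁅Φ, T₁ + T₂⁆ = -(s * (T₁ + T₂))
  lie_creation : ⁅Φ, E₁⁆ = E₁ * s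
  mul_resolvent : (algebraMap K A (2 * x) - E₁ * (T₁ + T₂)) * s = 1
  resolvent_mul : s * (algebraMap K A (2 * x) - E₁ * (T₁ + T₂)) = 1

/-- The part of the lower left entry `E₁ Z₂ + Z₁ E₂` of the fused Lax operator that is symmetric
in the two copies, `p` and `p'` having mean `x`. -/
def symmetricCreation (x : K) (E₁ E₂ T₁ T₂ : A) : A :=
  x • (E₁ + E₂) - E₁ * E₂ * (T₁ + T₂)

/-- The part of the difference `P₁ - P₂` of the two operators `A₊(p)` and `A₊(p')` that is
antisymmetric in the two copies, `p` and `p'` having mean `x`. -/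
def antisymmetricLowering (x : K) (E₁ E₂ T₁ T₂ : A) : A :=
  E₁ * T₁ * T₁ - E₂ * T₂ * T₂ - (2 * x) • (T₁ - T₂)

variable {x : K} {E₁ E₂ T₁ T₂ Φ Φ₁ Φ₂ s t : A}

theorem symmetricCreation_swap (x : K) (hE : Commute E₁ E₂) (T₁ T₂ : A) :
    symmetricCreation x E₂ E₁ T₂ T₁ = symmetricCreation x E₁ E₂ T₁ T₂ := by
  rw [symmetricCreation, symmetricCreation, add_comm E₂, add_comm T₂, hE.eq]

theorem antisymmetricLowering_swap (x : K) (E₁ E₂ T₁ T₂ : A) :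
    antisymmetricLowering x E₂ E₁ T₂ T₁ = -antisymmetricLowering x E₁ E₂ T₁ T₂ := by
  simp only [antisymmetricLowering, smul_sub]
  abel

theorem symmetricCreation_eq (x : K) (hE : Commute E₁ E₂) (T₁ T₂ : A) :
    symmetricCreation x E₁ E₂ T₁ T₂ = E₁ * (algebraMap K A (2 * x) - E₁ * (T₁ + T₂))
      + (E₁ - E₂) * (E₁ * (T₁ + T₂) - algebraMap K A x) := by
  have hx (a : A) : a * algebraMap K A x = x • a := by rw [Algebra.smul_def, Algebra.commutes]
  have hE' (a : A) : E₂ * (E₁ * a) = E₁ * (E₂ * a) := by rw [← mul_assoc, ← hE.eq, mul_assoc]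
  simp only [symmetricCreation, two_mul, map_add, mul_add, mul_sub, sub_mul, mul_assoc,
    hE', hx, smul_sub, smul_add]
  abel

theorem antisymmetricLowering_eq (x : K) (E₁ E₂ : A) (hT : Commute T₁ T₂) :
    antisymmetricLowering x E₁ E₂ T₁ T₂ =
      (algebraMap K A (2 * x) - E₁ * (T₁ + T₂)) * (T₂ + T₂ - (T₁ + T₂))
        + (E₁ - E₂) * (T₂ * T₂) := by
  simp only [antisymmetricLowering, Algebra.smul_def, mul_add, mul_sub, sub_mul, add_mul,
    mul_assoc, hT.eq]
  abel

namespace IsDigamma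

theorem map (h : IsDigamma x E₁ E₂ T₁ T₂ Φ s) (f : A →ₐ[K] B) :
    IsDigamma x (f E₁) (f E₂) (f T₁) (f T₂) (f Φ) (f s) where
  commute_sub := by simpa only [map_sub] using h.commute_sub.map f
  commute_annihilation := h.commute_annihilation.map f
  lie_add := by rw [← map_add, lie_map, h.lie_add, map_neg, map_mul]
  lie_creation := by rw [lie_map, h.lie_creation, map_mul]
  mul_resolvent := by
    simpa only [map_sub, map_mul, map_add, map_one, AlgHom.commutes]
      using congrArg f h.mul_resolvent
  resolvent_mul := by
    simpa only [map_sub, map_mul, map_add, map_one, AlgHom.commutes]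
      using congrArg f h.resolvent_mul

theorem commute_number (h : IsDigamma x E₁ E₂ T₁ T₂ Φ s) : Commute Φ (E₁ * (T₁ + T₂)) := by
  rw [commute_iff_lie_eq, lie_mul, h.lie_creation, h.lie_add, mul_neg, mul_assoc, add_neg_cancel]

theorem commute_number_sub (h : IsDigamma x E₁ E₂ T₁ T₂ Φ s) (c : K) :
    Commute Φ (E₁ * (T₁ + T₂) - algebraMap K A c) :=
  h.commute_number.sub_right (Algebra.commutes c Φ).symm

theorem commute_sub_number (h : IsDigamma x E₁ E₂ T₁ T₂ Φ s) (c : K) :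
    Commute Φ (algebraMap K A c - E₁ * (T₁ + T₂)) :=
  .sub_right (Algebra.commutes c Φ).symm h.commute_number

theorem commute_resolvent (h : IsDigamma x E₁ E₂ T₁ T₂ Φ s) : Commute Φ s :=
  commute_of_mul_eq_one (h.commute_sub_number _) h.mul_resolvent h.resolvent_mul

theorem lie_symmetricCreation (h : IsDigamma x E₁ E₂ T₁ T₂ Φ s) (hE : Commute E₁ E₂) :
    ⁅Φ, symmetricCreation x E₁ E₂ T₁ T₂⁆ = E₁ := by
  rw [symmetricCreation_eq x hE, _root_.lie_add, lie_mul, lie_mul, h.lie_creation,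
    (h.commute_sub_number _).lie_eq, (h.commute_number_sub _).lie_eq, h.commute_sub.lie_eq,
    mul_assoc, h.resolvent_mul]
  simp only [mul_one, mul_zero, zero_mul, add_zero]

theorem lie_antisymmetricLowering (h : IsDigamma x E₁ E₂ T₁ T₂ Φ s) (hT : Commute T₁ T₂) :
    ⁅Φ, antisymmetricLowering x E₁ E₂ T₁ T₂⁆ = T₁ + T₂ := by
  have hT₂ := h.commute_annihilation
  rw [antisymmetricLowering_eq x E₁ E₂ hT, _root_.lie_add, lie_mul, lie_mul,
    lie_sub Φ (T₂ + T₂), (h.commute_sub_number _).lie_eq, h.commute_sub.lie_eq,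
    (hT₂.add_right hT₂).lie_eq, (hT₂.mul_right hT₂).lie_eq, h.lie_add, zero_sub, neg_neg,
    ← mul_assoc, h.mul_resolvent]
  simp only [one_mul, mul_zero, zero_mul, add_zero, zero_add]

variable (h₁ : IsDigamma x E₁ E₂ T₁ T₂ Φ₁ s) (h₂ : IsDigamma x E₂ E₁ T₂ T₁ Φ₂ t)
include h₁ h₂

theorem commute_sub_sub : Commute (Φ₁ - Φ₂) (E₁ - E₂) :=
  h₁.commute_sub.sub_left (neg_sub E₂ E₁ ▸ h₂.commute_sub.neg_right)

theorem lie_sub_symmetricCreation (hE : Commute E₁ E₂) :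
    ⁅Φ₁ - Φ₂, symmetricCreation x E₁ E₂ T₁ T₂⁆ = E₁ - E₂ := by
  rw [sub_lie, h₁.lie_symmetricCreation hE, ← symmetricCreation_swap x hE,
    h₂.lie_symmetricCreation hE.symm]

theorem lie_sub_antisymmetricLowering (hT : Commute T₁ T₂) :
    ⁅Φ₁ - Φ₂, antisymmetricLowering x E₁ E₂ T₁ T₂⁆ = (2 : K) • (T₁ + T₂) := by
  rw [sub_lie, h₁.lie_antisymmetricLowering hT, ← neg_neg (antisymmetricLowering x E₁ E₂ T₁ T₂),
    ← antisymmetricLowering_swap, lie_neg, h₂.lie_antisymmetricLowering hT.symm, sub_neg_eq_add,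
    add_comm T₂, two_smul]

theorem lie_sub_annihilation :
    ⁅Φ₁ - Φ₂, T₁ + T₂⁆ = t * (T₁ + T₂) - s * (T₁ + T₂) := by
  rw [sub_lie, h₁.lie_add, add_comm T₁, h₂.lie_add, sub_neg_eq_add, neg_add_eq_sub]

theorem commute_sub_resolvent_mul (hE : Commute E₁ E₂)
    (hET : Commute (E₁ - E₂) (T₁ + T₂)) : Commute (Φ₁ - Φ₂) (s * (T₁ + T₂)) := by
  have hD : Commute (E₁ - E₂) t := by
    refine commute_of_mul_eq_one (.sub_right (Algebra.commutes _ _).symm (.mul_right ?_ ?_))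
      h₂.mul_resolvent h₂.resolvent_mul
    · exact hE.sub_left (.refl E₂)
    · rwa [add_comm T₂]
  have hK : algebraMap K A (2 * x) - E₁ * (T₁ + T₂)
      = algebraMap K A (2 * x) - E₂ * (T₂ + T₁) - (E₁ - E₂) * (T₁ + T₂) := by
    rw [add_comm T₂, sub_mul]
    abel
  -- The second resolvent identity, which makes the bracket of `Φ₂` with `s` computable.
  have hst : t * ((E₁ - E₂) * (T₁ + T₂)) * s = s - t := by
    rw [← sub_sub_cancel (algebraMap K A (2 * x) - E₂ * (T₂ + T₁)) ((E₁ - E₂) * (T₁ + T₂)), ← hK,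
      mul_sub, sub_mul, h₂.resolvent_mul, one_mul, mul_assoc, h₁.mul_resolvent, mul_one]
  have hΦ₂ : ⁅Φ₂, s⁆ = -(s * (s - t)) := by
    have hD₂ : Commute Φ₂ (E₁ - E₂) := neg_sub E₂ E₁ ▸ h₂.commute_sub.neg_right
    rw [lie_of_mul_eq_one h₁.mul_resolvent h₁.resolvent_mul, hK, lie_sub, lie_mul,
      (h₂.commute_sub_number _).lie_eq, hD₂.lie_eq, add_comm T₁, h₂.lie_add, add_comm T₂,
      zero_mul, zero_add, mul_neg, zero_sub, neg_neg, ← mul_assoc (E₁ - E₂), hD.eq, mul_assoc t,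
      mul_assoc s, hst]
  rw [commute_iff_lie_eq, sub_lie, lie_mul, lie_mul, h₁.commute_resolvent.lie_eq, h₁.lie_add,
    hΦ₂, add_comm T₁, h₂.lie_add]
  noncomm_ring

theorem commute_sub_lie_sub (hE : Commute E₁ E₂) (hET : Commute (E₁ - E₂) (T₁ + T₂)) :
    Commute (Φ₁ - Φ₂) (t * (T₁ + T₂) - s * (T₁ + T₂)) := by
  have ht := h₂.commute_sub_resolvent_mul h₁ hE.symm
    (by simpa only [neg_sub, add_comm T₂] using hET.neg_left)
  rw [← neg_sub, add_comm T₂] at ht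
  exact (Commute.neg_left_iff.1 ht).sub_right (h₁.commute_sub_resolvent_mul h₂ hE hET)

end IsDigamma

end Digamma

section WeakExponential

variable {V : Type*} [AddCommGroup V] [Module ℂ V]

/-- `R` is the exponential of `X` in the weak sense that all matrix elements of the exponential
series of `X` converge to those of `R`. Unlike `NormedSpace.exp`, this makes sense without a
topology on `V`, and it is what is needed to compare operators on the infinite-dimensional space
of two auxiliary spaces. -/
def IsWeakExp (R X : Module.End ℂ V) : Prop :=
  ∀ (φ : Module.Dual ℂ V) (v : V),
    HasSum (fun n : ℕ => (n.factorial : ℂ)⁻¹ * φ ((X ^ n) v)) (φ (R v))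

theorem pow_mul_eq_sum_ad (K : Type*) {A : Type*} [CommRing K] [Ring A] [Algebra K A]
    (X Z : A) (n : ℕ) :
    X ^ n * Z = ∑ ij ∈ antidiagonal n,
      n.choose ij.1 • ((LieAlgebra.ad K A X ^ ij.1) Z * X ^ ij.2) := by
  have hcomm : Commute (LieAlgebra.ad K A X) (LinearMap.mulRight K X) := by
    rw [LieAlgebra.ad_eq_lmul_left_sub_lmul_right]
    exact (LinearMap.commute_mulLeft_right X X).sub_left (.refl _)
  have hadd : LieAlgebra.ad K A X + LinearMap.mulRight K X = LinearMap.mulLeft K X := by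
    rw [LieAlgebra.ad_eq_lmul_left_sub_lmul_right]
    exact sub_add_cancel _ _
  calc X ^ n * Z = ((LieAlgebra.ad K A X + LinearMap.mulRight K X) ^ n) Z := by
        rw [hadd, LinearMap.pow_mulLeft, LinearMap.mulLeft_apply]
    _ = _ := by
        rw [hcomm.add_pow']
        simp only [LinearMap.sum_apply, LinearMap.smul_apply]
        refine sum_congr rfl fun ij _ => ?_
        rw [(hcomm.pow_pow _ _).eq, Module.End.mul_apply, LinearMap.pow_mulRight,
          LinearMap.mulRight_apply]

theorem hasSum_sum_antidiagonal {G : Type*} [AddCommMonoid G] [TopologicalSpace G]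
    [ContinuousAdd G] [RegularSpace G] {F : ℕ × ℕ → G} {a : ℕ → G} {m : ℕ}
    (hrow : ∀ i < m, HasSum (fun j => F (i, j)) (a i)) (hF : ∀ i, m ≤ i → ∀ j, F (i, j) = 0) :
    HasSum (fun n => ∑ ij ∈ antidiagonal n, F ij) (∑ i ∈ range m, a i) := by
  have hrows : HasSum (fun ij : ℕ × ℕ => ∑ i ∈ range m, if ij.1 = i then F ij else 0)
      (∑ i ∈ range m, a i) := by
    refine hasSum_sum fun i hi => ?_
    rw [← (Prod.mk_right_injective i).hasSum_iff]
    · simpa only [Function.comp_def, if_true] using hrow i (mem_range.1 hi)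
    · rintro ⟨i', j⟩ hij
      exact if_neg fun h : i' = i => hij ⟨j, by rw [h]⟩
  have hF' (ij : ℕ × ℕ) : (∑ i ∈ range m, if ij.1 = i then F ij else 0) = F ij := by
    rw [sum_ite_eq, ite_eq_left_iff, mem_range, not_lt]
    exact fun h => (hF _ h _).symm
  simp only [hF'] at hrows
  exact
    (HasAntidiagonal.sigmaAntidiagonalEquivProd.hasSum_iff.2 hrows).sigma fun n => by
    rw [← sum_coe_sort]
    exact hasSum_fintype fun ij : HasAntidiagonal.antidiagonal n => F ij

theorem inv_factorial_mul_choose {K : Type*} [Field K] [CharZero K] (i j : ℕ) :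
    ((i + j).factorial : K)⁻¹ * ((i + j).choose i : K)
      = (i.factorial : K)⁻¹ * (j.factorial : K)⁻¹ := by
  have := Nat.choose_ne_zero (Nat.le_add_right i j)
  have := Nat.add_choose_mul_factorial_mul_factorial i j
  rw [← Nat.choose_symm_add] at this
  rw [← this]
  push_cast
  field_simp

theorem IsWeakExp.hasSum_ad {R X : Module.End ℂ V} (hR : IsWeakExp R X)
    {Z : Module.End ℂ V} {m : ℕ}
    (hZ : (LieAlgebra.ad ℂ (Module.End ℂ V) X ^ m) Z = 0) (φ : Module.Dual ℂ V) (v : V) :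
    HasSum (fun n => (n.factorial : ℂ)⁻¹ * φ ((X ^ n) (Z v)))
      (∑ i ∈ range m, (i.factorial : ℂ)⁻¹ *
        φ ((LieAlgebra.ad ℂ (Module.End ℂ V) X ^ i) Z (R v))) := by
  let W (i : ℕ) : Module.End ℂ V := (LieAlgebra.ad ℂ (Module.End ℂ V) X ^ i) Z
  let F (ij : ℕ × ℕ) : ℂ := (ij.1.factorial : ℂ)⁻¹ *
    ((ij.2.factorial : ℂ)⁻¹ * φ (W ij.1 ((X ^ ij.2) v)))
  have hrow (i : ℕ) (_ : i < m) :
      HasSum (fun j => F (i, j)) ((i.factorial : ℂ)⁻¹ * φ (W i (R v))) := by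
    simpa only [F, LinearMap.comp_apply]
      using (hR (φ ∘ₗ W i) v).mul_left (i.factorial : ℂ)⁻¹
  have hrow_zero (i : ℕ) (hi : m ≤ i) (j : ℕ) : F (i, j) = 0 := by
    obtain ⟨k, rfl⟩ := Nat.exists_eq_add_of_le' hi
    have hW : W (k + m) = 0 := by
      simp only [W, pow_add, Module.End.mul_apply, hZ, map_zero]
    simp only [F, hW, LinearMap.zero_apply, map_zero, mul_zero]
  convert hasSum_sum_antidiagonal hrow hrow_zero using 2 with n
  rw [← Module.End.mul_apply, pow_mul_eq_sum_ad ℂ, LinearMap.sum_apply, map_sum, mul_sum]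
  refine sum_congr rfl fun ij hij => ?_
  rw [← mem_antidiagonal.1 hij, LinearMap.smul_apply, map_nsmul, nsmul_eq_mul,
    Module.End.mul_apply, ← mul_assoc, inv_factorial_mul_choose, mul_assoc]

theorem IsWeakExp.semiconjBy {R X Z : Module.End ℂ V} (hR : IsWeakExp R X) {m : ℕ}
    (hZ : (LieAlgebra.ad ℂ (Module.End ℂ V) X ^ m) Z = 0) :
    SemiconjBy R Z (∑ i ∈ range m,
      (i.factorial : ℂ)⁻¹ • (LieAlgebra.ad ℂ (Module.End ℂ V) X ^ i) Z) := by
  refine LinearMap.ext fun v => eq_of_sub_eq_zero <|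
    (Module.forall_dual_apply_eq_zero_iff ℂ _).1 fun φ => ?_
  simp only [map_sub, sub_eq_zero, Module.End.mul_apply, (hR φ (Z v)).unique (hR.hasSum_ad hZ φ v),
    LinearMap.sum_apply, map_sum, LinearMap.smul_apply, map_smul, smul_eq_mul]

theorem IsWeakExp.semiconjBy_self {R X Z : Module.End ℂ V} (hR : IsWeakExp R X)
    (h : Commute X Z) : SemiconjBy R Z Z := by
  have := hR.semiconjBy (m := 1) (Z := Z) (by simp [h.lie_eq])
  simpa using this

theorem IsWeakExp.semiconjBy_add_lie {R X Z : Module.End ℂ V} (hR : IsWeakExp R X)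
    (h : Commute X ⁅X, Z⁆) : SemiconjBy R Z (Z + ⁅X, Z⁆) := by
  have := hR.semiconjBy (m := 2) (Z := Z) (by simp [pow_two, h.lie_eq])
  simpa [sum_range_succ] using this

theorem IsWeakExp.semiconjBy_add_lie_add_lie_lie {R X Z : Module.End ℂ V} (hR : IsWeakExp R X)
    (h : Commute X ⁅X, ⁅X, Z⁆⁆) :
    SemiconjBy R Z (Z + ⁅X, Z⁆ + (2 : ℂ)⁻¹ • ⁅X, ⁅X, Z⁆⁆) := by
  have := hR.semiconjBy (m := 3) (Z := Z) (by simp [pow_succ, h.lie_eq])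
  simpa [sum_range_succ, pow_two] using this

namespace IsDigamma

variable {x y : ℂ} {E₁ E₂ T₁ T₂ Φ₁ Φ₂ s t R : Module.End ℂ V}
  (h₁ : IsDigamma x E₁ E₂ T₁ T₂ Φ₁ s) (h₂ : IsDigamma x E₂ E₁ T₂ T₁ Φ₂ t)
  (hR : IsWeakExp R (y • (Φ₁ - Φ₂)))
include h₁ h₂ hR

theorem semiconjBy_sub : SemiconjBy R (E₁ - E₂) (E₁ - E₂) :=
  hR.semiconjBy_self ((h₁.commute_sub_sub h₂).smul_left y)

theorem semiconjBy_symmetricCreation (hE : Commute E₁ E₂) :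
    SemiconjBy R (symmetricCreation x E₁ E₂ T₁ T₂ - (y / 2) • (E₁ - E₂))
      (symmetricCreation x E₁ E₂ T₁ T₂ - (-y / 2) • (E₁ - E₂)) := by
  have hH := h₁.commute_sub_sub h₂
  have hlie : ⁅y • (Φ₁ - Φ₂), symmetricCreation x E₁ E₂ T₁ T₂ - (y / 2) • (E₁ - E₂)⁆
      = y • (E₁ - E₂) := by
    rw [smul_lie, lie_sub, lie_smul, hH.lie_eq, h₁.lie_sub_symmetricCreation h₂ hE, smul_zero,
      sub_zero]
  convert hR.semiconjBy_add_lie (hlie ▸ (hH.smul_left y).smul_right y) using 1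
  rw [hlie]
  module

theorem semiconjBy_antisymmetricLowering (hE : Commute E₁ E₂) (hT : Commute T₁ T₂)
    (hET : Commute (E₁ - E₂) (T₁ + T₂)) :
    SemiconjBy R (antisymmetricLowering x E₁ E₂ T₁ T₂ - y • (T₁ + T₂))
      (antisymmetricLowering x E₁ E₂ T₁ T₂ - (-y) • (T₁ + T₂)) := by
  have hH := h₁.commute_sub_lie_sub h₂ hE hET
  have hlie : ⁅y • (Φ₁ - Φ₂), antisymmetricLowering x E₁ E₂ T₁ T₂ - y • (T₁ + T₂)⁆
      = y • ((2 : ℂ) • (T₁ + T₂) - y • (t * (T₁ + T₂) - s * (T₁ + T₂))) := by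
    rw [smul_lie, lie_sub, lie_smul, h₁.lie_sub_antisymmetricLowering h₂ hT,
      h₁.lie_sub_annihilation h₂]
  have hlie_lie : ⁅y • (Φ₁ - Φ₂), ⁅y • (Φ₁ - Φ₂),
      antisymmetricLowering x E₁ E₂ T₁ T₂ - y • (T₁ + T₂)⁆⁆
      = (2 * y * y) • (t * (T₁ + T₂) - s * (T₁ + T₂)) := by
    rw [hlie, smul_lie, lie_smul, lie_sub, lie_smul, lie_smul, h₁.lie_sub_annihilation h₂,
      hH.lie_eq]
    module
  convert hR.semiconjBy_add_lie_add_lie_lie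
    (hlie_lie ▸ (hH.smul_left y).smul_right (2 * y * y)) using 1
  rw [hlie_lie, hlie]
  module

end IsDigamma

end WeakExponential

section Fusion

variable {K A B : Type*} [Field K] [Ring A] [Algebra K A] [Ring B] [Algebra K B]

/-- The `sl₂` relations between the entries of the Lax matrix `!![Z, P; E, Z]` and the value `c` of
their Casimir element; for `A₀(p), A₊(p), A₋` this is `c = p (p + 1)`. -/
structure IsLaxTriple (c : K) (Z P E : A) : Prop where
  lie_lowering : ⁅Z, P⁆ = P
  lie_raising_lowering : ⁅E, P⁆ = (2 : K) • Z
  casimir : Z * Z + Z - E * P = algebraMap K A c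

theorem semiconjBy_of_smul {c : K} (hc : c ≠ 0) {R a b : A} (h : SemiconjBy R (c • a) (c • b)) :
    SemiconjBy R a b := by
  simpa only [inv_smul_smul₀ hc] using h.smul_right c⁻¹

namespace IsLaxTriple

variable {c c' : K} {Z P Z' P' E : A} {f g : A →ₐ[K] B}
  (h : IsLaxTriple c Z P E) (h' : IsLaxTriple c' Z' P' E) (hfg : ∀ a b, Commute (f a) (g b))
include h h' hfg

theorem lie_sub_sub : ⁅f E - g E, f P - g P'⁆ = (2 : K) • (f Z + g Z') := by
  simp only [lie_sub, sub_lie, lie_map, (hfg _ _).lie_eq, (hfg _ _).symm.lie_eq,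
    h.lie_raising_lowering, h'.lie_raising_lowering, map_smul]
  module

theorem lie_fused_sub : ⁅f E * g Z' + f Z * g E, f P - g P'⁆ = f P * g E - f E * g P' := by
  simp only [lie_sub, add_lie, mul_lie, lie_map, (hfg _ _).lie_eq, (hfg _ _).symm.lie_eq,
    h.lie_raising_lowering, h'.lie_raising_lowering, h.lie_lowering, h'.lie_lowering, map_smul,
    smul_mul_assoc, mul_smul_comm, mul_zero, zero_mul]
  abel

theorem lie_sub_fused_sub : ⁅f P * g E - f E * g P', f P - g P'⁆
    = -(2 : K) • (f Z * g P' + f P * g Z') := by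
  simp only [lie_sub, sub_lie, mul_lie, lie_map, (hfg _ _).lie_eq, (hfg _ _).symm.lie_eq,
    lie_self, h.lie_raising_lowering, h'.lie_raising_lowering, map_smul, smul_mul_assoc,
    mul_smul_comm, mul_zero, zero_mul]
  module

theorem fused_add_fused :
    f Z * g Z' + f P * g E + (f E * g P' + f Z * g Z')
      = (f Z + g Z') * (f Z + g Z') + (f Z + g Z') - (f E - g E) * (f P - g P')
        - algebraMap K B (c + c') := by
  have hc := congrArg f h.casimir
  have hc' := congrArg g h'.casimir
  simp only [map_sub, map_add, map_mul, AlgHom.commutes] at hc hc'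
  rw [map_add, ← hc, ← hc', (hfg P E).eq, add_mul, mul_add, mul_add, sub_mul, mul_sub, mul_sub,
    (hfg Z Z').symm.eq]
  abel

/-- The entries of the product of the Lax matrices of two copies of `sl₂` are generated, through
commutators and the two Casimir elements, by the three combinations in the hypotheses. -/
theorem semiconjBy_fused [NeZero (2 : K)] {R : B} (hE : SemiconjBy R (f E - g E) (f E - g E))
    (hP : SemiconjBy R (f P - g P') (f P' - g P))
    (hC : SemiconjBy R (f E * g Z' + f Z * g E) (f E * g Z + f Z' * g E)) (i j : Fin 2) :
    SemiconjBy R ((!![Z, P; E, Z].map f * !![Z', P'; E, Z'].map g) i j)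
      ((!![Z', P'; E, Z'].map f * !![Z, P; E, Z].map g) i j) := by
  have two_ne : (2 : K) ≠ 0 := two_ne_zero
  have hZ : SemiconjBy R (f Z + g Z') (f Z' + g Z) := by
    refine semiconjBy_of_smul two_ne ?_
    rw [← h.lie_sub_sub h' hfg, ← h'.lie_sub_sub h hfg]
    exact semiconjBy_lie hE hP
  have hsub : SemiconjBy R (f P * g E - f E * g P') (f P' * g E - f E * g P) := by
    rw [← h.lie_fused_sub h' hfg, ← h'.lie_fused_sub h hfg]
    exact semiconjBy_lie hC hP
  have hB : SemiconjBy R (f Z * g P' + f P * g Z') (f Z' * g P + f P' * g Z) := by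
    refine semiconjBy_of_smul (neg_ne_zero.2 two_ne) ?_
    rw [← h.lie_sub_fused_sub h' hfg, ← h'.lie_sub_fused_sub h hfg]
    exact semiconjBy_lie hsub hP
  have hadd : SemiconjBy R (f Z * g Z' + f P * g E + (f E * g P' + f Z * g Z'))
      (f Z' * g Z + f P' * g E + (f E * g P + f Z' * g Z)) := by
    rw [h.fused_add_fused h' hfg, h'.fused_add_fused h hfg, add_comm c' c]
    exact (((hZ.mul_right hZ).add_right hZ).sub_right (hE.mul_right hP)).sub_right
      (Algebra.commutes (c + c') R).symm
  have hA : SemiconjBy R (f Z * g Z' + f P * g E) (f Z' * g Z + f P' * g E) := by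
    refine semiconjBy_of_smul two_ne ?_
    convert hadd.add_right hsub using 1 <;> module
  have hD : SemiconjBy R (f E * g P' + f Z * g Z') (f E * g P + f Z' * g Z) := by
    refine semiconjBy_of_smul two_ne ?_
    convert hadd.sub_right hsub using 1 <;> module
  fin_cases i <;> fin_cases j <;> simpa [Matrix.mul_apply, Fin.sum_univ_two]

end IsLaxTriple

end Fusion

section ListProduct

variable {ι : Type*}

theorem semiconjBy_list_prod {M : Type*} [Monoid M] {a : M} {F G : ι → M}
    (h : ∀ i, SemiconjBy a (F i) (G i)) (l : List ι) :
    SemiconjBy a (l.map F).prod (l.map G).prod := by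
  induction l with
  | nil => simp only [List.map_nil, List.prod_nil, SemiconjBy.one_right]
  | cons i l ih => simpa only [List.map_cons, List.prod_cons] using (h i).mul_right ih

theorem list_prod_mul_prod {M : Type*} [Monoid M] {F G : ι → M}
    (h : ∀ i j, i ≠ j → Commute (F i) (G j)) {l : List ι} (hl : l.Nodup) :
    (l.map F).prod * (l.map G).prod = (l.map fun i => F i * G i).prod := by
  induction l with
  | nil => simp only [List.map_nil, List.prod_nil, mul_one]
  | cons i l ih =>
    obtain ⟨hi, hl⟩ := List.nodup_cons.1 hl
    have hcomm : Commute (l.map F).prod (G i) := by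
      refine Commute.list_prod_left _ _ fun z hz => ?_
      obtain ⟨j, hj, rfl⟩ := List.mem_map.1 hz
      exact h j i (ne_of_mem_of_not_mem hj hi)
    simp only [List.map_cons, List.prod_cons, ← ih hl, mul_assoc, hcomm.left_comm]

theorem continuous_list_prod_add_smul {K A : Type*} [CommSemiring K] [TopologicalSpace K]
    [IsTopologicalSemiring K] [Semiring A] [Algebra K A] (a b : ι → A) (l : List ι)
    (φ : A →ₗ[K] K) : Continuous fun c : K => φ (l.map fun i => a i + c • b i).prod := by
  induction l generalizing φ with
  | nil => exact continuous_const (y := φ 1)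
  | cons i l ih =>
    simp only [List.map_cons, List.prod_cons, add_mul, smul_mul_assoc, map_add, map_smul,
      smul_eq_mul]
    exact (ih (φ ∘ₗ LinearMap.mulLeft K (a i))).add
      (continuous_id.mul (ih (φ ∘ₗ LinearMap.mulLeft K (b i))))

end ListProduct

section Site

variable {ι κ B C : Type*} [Fintype ι] [DecidableEq ι] [DecidableEq κ] [Semiring B] [Semiring C]

/-- A matrix with entries in `B`, acting on the site `k` of a chain with sites `ι` and one-site
states `κ`, and as the identity on the other sites. -/
def siteMatrix (k : ι) (M : Matrix κ κ B) : Matrix (ι → κ) (ι → κ) B :=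
  Matrix.of fun ν ν' => if ∀ j, j ≠ k → ν j = ν' j then M (ν k) (ν' k) else 0

theorem siteMatrix_apply (k : ι) (M : Matrix κ κ B) (ν ν' : ι → κ) :
    siteMatrix k M ν ν' = if ∀ j, j ≠ k → ν j = ν' j then M (ν k) (ν' k) else 0 := rfl

theorem siteMatrix_eq_submatrix (k : ι) (M : Matrix κ κ B) :
    siteMatrix k M = (Matrix.blockDiagonal fun _ => M).submatrix (Equiv.funSplitAt k κ)
      (Equiv.funSplitAt k κ) := by
  ext ν ν'
  simp [siteMatrix_apply, Matrix.blockDiagonal_apply, funext_iff]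

theorem siteMatrix_map (f : B →+* C) (k : ι) (M : Matrix κ κ B) :
    (siteMatrix k M).map f = siteMatrix k (M.map f) := by
  ext ν ν'
  simp only [siteMatrix_apply, Matrix.map_apply, apply_ite f, map_zero]

variable [Fintype κ]

theorem siteMatrix_mul (k : ι) (M N : Matrix κ κ B) :
    siteMatrix k M * siteMatrix k N = siteMatrix k (M * N) := by
  simp only [siteMatrix_eq_submatrix, Matrix.submatrix_mul_equiv, Matrix.blockDiagonal_mul]

theorem siteMatrix_mul_apply_of_ne {j k : ι} (hjk : j ≠ k) (M N : Matrix κ κ B) (ν ν' : ι → κ) :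
    (siteMatrix j M * siteMatrix k N) ν ν'
      = if ∀ i, i ≠ j → i ≠ k → ν i = ν' i then M (ν j) (ν' j) * N (ν k) (ν' k) else 0 := by
  rw [Matrix.mul_apply, sum_eq_single (Function.update ν j (ν' j))]
  · have hk : (∀ i, i ≠ k → Function.update ν j (ν' j) i = ν' i)
        ↔ ∀ i, i ≠ j → i ≠ k → ν i = ν' i := by
      refine forall_congr' fun i => ?_
      rcases eq_or_ne i j with rfl | hij
      · simp
      · simp [hij]
    rw [siteMatrix_apply, if_pos fun i hi => (Function.update_of_ne hi _ _).symm,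
      siteMatrix_apply, Function.update_self, Function.update_of_ne hjk.symm, if_congr hk rfl rfl,
      mul_ite, mul_zero]
  · intro μ _ hμ
    by_contra hne
    have hj := (ite_ne_right_iff.1 (left_ne_zero_of_mul hne)).1
    have hk := (ite_ne_right_iff.1 (right_ne_zero_of_mul hne)).1
    exact hμ (Function.eq_update_iff.2 ⟨hk j hjk, fun i hi => (hj i hi).symm⟩)
  · exact fun h => absurd (mem_univ _) h

theorem commute_siteMatrix {j k : ι} (hjk : j ≠ k) {M N : Matrix κ κ B}
    (h : ∀ a b c d, Commute (M a b) (N c d)) : Commute (siteMatrix j M) (siteMatrix k N) := by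
  ext ν ν'
  rw [siteMatrix_mul_apply_of_ne hjk, siteMatrix_mul_apply_of_ne hjk.symm]
  exact if_congr (forall_congr' fun i => forall_comm) (h _ _ _ _).eq rfl

end Site

section AuxiliarySpace

-- These group structures extend the additive monoids that appear in the types of the operators
-- above; the instances found by default do so only up to unfolding.

local instance : AddCommGroup Aux := Module.addCommMonoidToAddCommGroup ℂ

local instance : AddCommGroup (Aux ⊗[ℂ] Aux) := Module.addCommMonoidToAddCommGroup ℂ

/-- The annihilation operator `∑ₖ |k⟩⟨k+1|`, for which `A₋` is the creation operator. -/
def opLower : Module.End ℂ Aux :=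
  Finsupp.linearCombination ℂ fun j =>
    match j with
    | 0 => 0
    | k + 1 => ket k

theorem opZero_ket (p : ℂ) (k : ℕ) : opZero p (ket k) = (p - k) • ket k := by
  simp [opZero, ket, ampZero]

theorem opPlus_ket_zero (p : ℂ) : opPlus p (ket 0) = 0 := by
  simp [opPlus, ket]

theorem opPlus_ket_succ (p : ℂ) (k : ℕ) :
    opPlus p (ket (k + 1)) = ((k : ℂ) - 2 * p) • ket k := by
  simp [opPlus, ket, ampPlus]

theorem opMinus_ket (k : ℕ) : opMinus (ket k) = ((k : ℂ) + 1) • ket (k + 1) := by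
  simp [opMinus, ket, ampMinus]

theorem opLower_ket_zero : opLower (ket 0) = 0 := by
  simp [opLower, ket]

theorem opLower_ket_succ (k : ℕ) : opLower (ket (k + 1)) = ket k := by
  simp [opLower, ket]

theorem aux_ext {W : Type*} [AddCommMonoid W] [Module ℂ W] {f g : Aux →ₗ[ℂ] W}
    (h : ∀ k, f (ket k) = g (ket k)) : f = g :=
  Finsupp.lhom_ext' fun k => LinearMap.ext_ring (h k)

theorem lie_opLower_opMinus : ⁅opLower, opMinus⁆ = 1 := by
  refine aux_ext fun k => ?_
  cases k <;>
    simp [Ring.lie_def, opMinus_ket, opLower_ket_succ, opLower_ket_zero, add_smul]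

theorem opZero_eq (p : ℂ) : opZero p = p • 1 - opMinus * opLower := by
  refine aux_ext fun k => ?_
  cases k <;> simp [opZero_ket, opLower_ket_zero, opLower_ket_succ, opMinus_ket, sub_smul]

theorem opPlus_eq (p : ℂ) : opPlus p = opMinus * opLower * opLower - (2 * p) • opLower := by
  refine aux_ext fun k => ?_
  rcases k with _ | _ | k <;>
    simp only [LinearMap.sub_apply, LinearMap.smul_apply, Module.End.mul_apply, opPlus_ket_zero,
      opPlus_ket_succ, opLower_ket_zero, opLower_ket_succ, opMinus_ket, map_zero, Nat.cast_succ,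
      Nat.cast_zero] <;> module

theorem isLaxTriple_op (p : ℂ) : IsLaxTriple (p * (p + 1)) (opZero p) (opPlus p) opMinus where
  lie_lowering := by
    refine aux_ext fun k => ?_
    cases k <;> simp only [Ring.lie_def, LinearMap.sub_apply, Module.End.mul_apply, opZero_ket,
      opPlus_ket_zero, opPlus_ket_succ, map_zero, map_smul, Nat.cast_succ] <;> module
  lie_raising_lowering := by
    refine aux_ext fun k => ?_
    cases k <;> simp only [Ring.lie_def, LinearMap.sub_apply, Module.End.mul_apply, opZero_ket,
      opMinus_ket, LinearMap.smul_apply, opPlus_ket_zero, opPlus_ket_succ, map_zero, map_smul,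
      Nat.cast_succ, Nat.cast_zero] <;> module
  casimir := by
    refine aux_ext fun k => ?_
    cases k <;> simp only [LinearMap.sub_apply, LinearMap.add_apply, Module.End.mul_apply,
      opZero_ket, opMinus_ket, Module.algebraMap_end_apply, opPlus_ket_zero, opPlus_ket_succ,
      map_zero, map_smul, Nat.cast_succ, Nat.cast_zero] <;> module

/-- `A ↦ A ⊗ 1`, the operators on the first of the two auxiliary spaces. -/
def onFst : Module.End ℂ Aux →ₐ[ℂ] Module.End ℂ (Aux ⊗[ℂ] Aux) := Module.End.rTensorAlgHom ℂ Aux Aux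

/-- `A ↦ 1 ⊗ A`, the operators on the second of the two auxiliary spaces. -/
def onSnd : Module.End ℂ Aux →ₐ[ℂ] Module.End ℂ (Aux ⊗[ℂ] Aux) := Module.End.lTensorAlgHom ℂ Aux Aux

theorem commute_onFst_onSnd (A B : Module.End ℂ Aux) : Commute (onFst A) (onSnd B) :=
  TensorProduct.ext' fun _ _ => rfl

theorem ketBasis_apply (k l : ℕ) : ketBasis (k, l) = ket k ⊗ₜ ket l := by
  simp [ketBasis, ket]

theorem ketBasis_ext {W : Type*} [AddCommMonoid W] [Module ℂ W] {f g : Aux ⊗[ℂ] Aux →ₗ[ℂ] W}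
    (h : ∀ k l, f (ketBasis (k, l)) = g (ketBasis (k, l))) : f = g :=
  ketBasis.ext fun b => h b.1 b.2

theorem onFst_tmul (A : Module.End ℂ Aux) (u v : Aux) : onFst A (u ⊗ₜ v) = A u ⊗ₜ v := rfl

theorem onSnd_tmul (A : Module.End ℂ Aux) (u v : Aux) : onSnd A (u ⊗ₜ v) = u ⊗ₜ A v := rfl

theorem onFst_ketBasis (A : Module.End ℂ Aux) (k l : ℕ) :
    onFst A (ketBasis (k, l)) = A (ket k) ⊗ₜ ket l := by
  rw [ketBasis_apply, onFst_tmul]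

theorem onSnd_ketBasis (A : Module.End ℂ Aux) (k l : ℕ) :
    onSnd A (ketBasis (k, l)) = ket k ⊗ₜ A (ket l) := by
  rw [ketBasis_apply, onSnd_tmul]

theorem onFst_opMinus_ketBasis (l j : ℕ) :
    onFst opMinus (ketBasis (l, j)) = ((l : ℂ) + 1) • ketBasis (l + 1, j) := by
  rw [onFst_ketBasis, opMinus_ket, ← TensorProduct.smul_tmul', ketBasis_apply]

theorem onSnd_opMinus_ketBasis (l j : ℕ) :
    onSnd opMinus (ketBasis (l, j)) = ((j : ℂ) + 1) • ketBasis (l, j + 1) := by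
  rw [onSnd_ketBasis, opMinus_ket, TensorProduct.tmul_smul, ketBasis_apply]

theorem onFst_opLower_ketBasis_zero (j : ℕ) : onFst opLower (ketBasis (0, j)) = 0 := by
  rw [onFst_ketBasis, opLower_ket_zero, TensorProduct.zero_tmul]

theorem onFst_opLower_ketBasis_succ (l j : ℕ) :
    onFst opLower (ketBasis (l + 1, j)) = ketBasis (l, j) := by
  rw [onFst_ketBasis, opLower_ket_succ, ketBasis_apply]

theorem onSnd_opLower_ketBasis_zero (l : ℕ) : onSnd opLower (ketBasis (l, 0)) = 0 := by
  rw [onSnd_ketBasis, opLower_ket_zero, TensorProduct.tmul_zero]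

/-- Conjugation by the exchange `|k, l⟩ ↦ |l, k⟩` of the two auxiliary spaces. -/
def exchange : Module.End ℂ (Aux ⊗[ℂ] Aux) →ₐ[ℂ] Module.End ℂ (Aux ⊗[ℂ] Aux) :=
  (LinearEquiv.conjAlgEquiv ℂ (TensorProduct.comm ℂ Aux Aux)).toAlgHom

theorem exchange_ketBasis (X : Module.End ℂ (Aux ⊗[ℂ] Aux)) (k l : ℕ) :
    exchange X (ketBasis (k, l)) = TensorProduct.comm ℂ Aux Aux (X (ketBasis (l, k))) := by
  rw [ketBasis_apply, ketBasis_apply]; rfl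

theorem comm_ketBasis (k l : ℕ) :
    TensorProduct.comm ℂ Aux Aux (ketBasis (k, l)) = ketBasis (l, k) := by
  rw [ketBasis_apply, ketBasis_apply, TensorProduct.comm_tmul]

theorem exchange_onFst (A : Module.End ℂ Aux) : exchange (onFst A) = onSnd A :=
  TensorProduct.ext' fun _ _ => rfl

theorem exchange_onSnd (A : Module.End ℂ Aux) : exchange (onSnd A) = onFst A :=
  TensorProduct.ext' fun _ _ => rfl

section NumberFunction

/-- The coefficient of `|l+n, j-n⟩` in `h(E₁ (T₁ + T₂)) |l, j⟩`, whatever `j ≥ n`. -/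
def newtonCoeff (h : ℕ → ℂ) (l n : ℕ) : ℂ := ((l + n).choose n : ℂ) * (fwdDiff 1)^[n] h l

theorem newtonCoeff_zero (h : ℕ → ℂ) (l : ℕ) : newtonCoeff h l 0 = h l := by
  simp [newtonCoeff]

theorem newtonCoeff_succ (h : ℕ → ℂ) (l n : ℕ) :
    ((n : ℂ) + 1) * newtonCoeff h l (n + 1)
      = ((l : ℂ) + 1) * newtonCoeff h (l + 1) n - ((l : ℂ) + n + 1) * newtonCoeff h l n := by
  have choose_succ_succ : ((n : ℂ) + 1) * ((l + (n + 1)).choose (n + 1) : ℂ)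
      = ((l : ℂ) + n + 1) * ((l + n).choose n : ℂ) := by
    exact_mod_cast (mul_comm _ _).trans (Nat.add_one_mul_choose_eq (l + n) n).symm
  have choose_succ : ((l : ℂ) + 1) * ((l + 1 + n).choose n : ℂ)
      = ((l : ℂ) + n + 1) * ((l + n).choose n : ℂ) := by
    rw [← Nat.choose_symm_add, ← Nat.choose_symm_add, add_right_comm l 1 n]
    exact_mod_cast (mul_comm _ _).trans (Nat.add_one_mul_choose_eq (l + n) l).symm
  rw [newtonCoeff, newtonCoeff, newtonCoeff, ← mul_assoc, choose_succ_succ, ← mul_assoc,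
    choose_succ, Function.iterate_succ_apply', fwdDiff]
  ring

/-- The function `h` of the operator `E₁ (T₁ + T₂)`, where `E_i` and `T_i` are the creation and
annihilation operators. The operator is triangular with spectrum `ℕ`, and its functions are given
by Newton's forward difference formula. -/
def numberFun (h : ℕ → ℂ) : Module.End ℂ (Aux ⊗[ℂ] Aux) :=
  ketBasis.constr ℂ fun b =>
    ∑ n ∈ antidiagonal b.2, newtonCoeff h b.1 n.1 • ketBasis (b.1 + n.1, n.2)

theorem numberFun_ketBasis (h : ℕ → ℂ) (l j : ℕ) : numberFun h (ketBasis (l, j))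
    = ∑ n ∈ antidiagonal j, newtonCoeff h l n.1 • ketBasis (l + n.1, n.2) := by
  rw [numberFun, Module.Basis.constr_basis]

theorem numberFun_ketBasis_zero (h : ℕ → ℂ) (l : ℕ) :
    numberFun h (ketBasis (l, 0)) = h l • ketBasis (l, 0) := by
  simp [numberFun_ketBasis, newtonCoeff_zero]

theorem smul_numberFun_sub (h : ℕ → ℂ) (l j : ℕ) :
    ((j : ℂ) + 1) • numberFun h (ketBasis (l, j + 1))
        - onSnd opMinus (numberFun h (ketBasis (l, j)))
      = ∑ n ∈ antidiagonal j,
          (((n.1 : ℂ) + 1) * newtonCoeff h l (n.1 + 1)) • ketBasis (l + n.1 + 1, n.2) := by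
  have creation : onSnd opMinus (numberFun h (ketBasis (l, j)))
      = ∑ n ∈ antidiagonal (j + 1),
          ((n.2 : ℂ) * newtonCoeff h l n.1) • ketBasis (l + n.1, n.2) := by
    rw [Nat.sum_antidiagonal_succ']
    simp only [numberFun_ketBasis, map_sum, map_smul, onSnd_opMinus_ketBasis, smul_smul,
      Nat.cast_zero, Nat.cast_succ, zero_mul, zero_smul, zero_add, mul_comm (newtonCoeff _ _ _)]
  have shift : ∑ n ∈ antidiagonal j,
        (((n.1 : ℂ) + 1) * newtonCoeff h l (n.1 + 1)) • ketBasis (l + n.1 + 1, n.2)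
      = ∑ n ∈ antidiagonal (j + 1),
          ((n.1 : ℂ) * newtonCoeff h l n.1) • ketBasis (l + n.1, n.2) := by
    rw [Nat.sum_antidiagonal_succ]
    simp only [Nat.cast_zero, Nat.cast_succ, zero_mul, zero_smul, zero_add, ← add_assoc]
  rw [sub_eq_iff_eq_add, creation, shift, ← sum_add_distrib, numberFun_ketBasis, smul_sum]
  refine sum_congr rfl fun n hn => ?_
  have hj : (n.1 : ℂ) + n.2 = (j : ℂ) + 1 := mod_cast mem_antidiagonal.1 hn
  rw [smul_smul, ← add_smul, ← add_mul, hj]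

theorem commute_numberFun_sub (h : ℕ → ℂ) :
    Commute (numberFun h) (onFst opMinus - onSnd opMinus) := by
  refine ketBasis_ext fun l j => ?_
  suffices ((j : ℂ) + 1) • numberFun h (ketBasis (l, j + 1))
        - onSnd opMinus (numberFun h (ketBasis (l, j)))
      = ((l : ℂ) + 1) • numberFun h (ketBasis (l + 1, j))
        - onFst opMinus (numberFun h (ketBasis (l, j))) by
    simp only [Module.End.mul_apply, LinearMap.sub_apply, map_sub, onFst_opMinus_ketBasis,
      onSnd_opMinus_ketBasis, map_smul]
    rw [sub_eq_sub_iff_sub_eq_sub, this]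
  rw [smul_numberFun_sub]
  simp only [numberFun_ketBasis, map_sum, map_smul, onFst_opMinus_ketBasis, smul_sum, smul_smul,
    ← sum_sub_distrib, add_right_comm l 1, ← sub_smul, newtonCoeff_succ]
  refine sum_congr rfl fun n _ => ?_
  push_cast
  ring_nf

theorem ext_of_commute_sub {X Y : Module.End ℂ (Aux ⊗[ℂ] Aux)}
    (hX : Commute X (onFst opMinus - onSnd opMinus))
    (hY : Commute Y (onFst opMinus - onSnd opMinus))
    (h : ∀ l, X (ketBasis (l, 0)) = Y (ketBasis (l, 0))) : X = Y := by
  have creation_recursion {Z : Module.End ℂ (Aux ⊗[ℂ] Aux)}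
      (hZ : Commute Z (onFst opMinus - onSnd opMinus)) (l j : ℕ) :
      ((j : ℂ) + 1) • Z (ketBasis (l, j + 1)) = ((l : ℂ) + 1) • Z (ketBasis (l + 1, j))
        - (onFst opMinus - onSnd opMinus) (Z (ketBasis (l, j))) := by
    rw [← Module.End.mul_apply, ← hZ.eq, Module.End.mul_apply, LinearMap.sub_apply,
      onFst_opMinus_ketBasis, onSnd_opMinus_ketBasis, map_sub, map_smul, map_smul, sub_sub_cancel]
  refine ketBasis_ext fun l j => ?_
  induction j generalizing l with
  | zero => exact h l
  | succ j ih =>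
    refine smul_right_injective _ (Nat.cast_add_one_ne_zero (R := ℂ) j) ?_
    simp only [creation_recursion hX, creation_recursion hY, ih]

theorem commute_onFst_opMinus_sub : Commute (onFst opMinus) (onFst opMinus - onSnd opMinus) :=
  (Commute.refl _).sub_right (commute_onFst_onSnd _ _)

theorem commute_opLower_add_opMinus_sub :
    Commute (onFst opLower + onSnd opLower) (onFst opMinus - onSnd opMinus) :=
  commute_add_sub_of_lie_eq (by simp only [lie_map, lie_opLower_opMinus, map_one])
    (commute_onFst_onSnd _ _) (commute_onFst_onSnd _ _).symm

theorem numberFun_mul (g h : ℕ → ℂ) : numberFun g * numberFun h = numberFun (g * h) :=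
  ext_of_commute_sub ((commute_numberFun_sub g).mul_left (commute_numberFun_sub h))
    (commute_numberFun_sub _) fun l => by
    simp only [Module.End.mul_apply, numberFun_ketBasis_zero, map_smul, smul_smul, Pi.mul_apply,
      mul_comm]

theorem numberFun_one : numberFun 1 = 1 :=
  ext_of_commute_sub (commute_numberFun_sub 1) (Commute.one_left _) fun l => by
    simp [numberFun_ketBasis_zero]

theorem numberFun_const_sub (c : ℂ) : numberFun (fun k => c - k)
    = algebraMap ℂ _ c - onFst opMinus * (onFst opLower + onSnd opLower) := by
  refine ext_of_commute_sub (commute_numberFun_sub _)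
    ((Algebra.commute_algebraMap_left c _).sub_left
      (commute_onFst_opMinus_sub.mul_left commute_opLower_add_opMinus_sub)) fun l => ?_
  cases l <;> simp only [numberFun_ketBasis_zero, LinearMap.sub_apply, Module.algebraMap_end_apply,
    Module.End.mul_apply, LinearMap.add_apply, onSnd_opLower_ketBasis_zero,
    onFst_opLower_ketBasis_zero, onFst_opLower_ketBasis_succ, add_zero, map_zero,
    onFst_opMinus_ketBasis, Nat.cast_zero, Nat.cast_succ] <;> module

theorem lie_numberFun_onFst_opMinus (h : ℕ → ℂ) :
    ⁅numberFun h, onFst opMinus⁆ = onFst opMinus * numberFun (fwdDiff 1 h) := by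
  have hE := commute_onFst_opMinus_sub
  have hΦ := commute_numberFun_sub h
  refine ext_of_commute_sub (commute_lie hΦ hE)
    (hE.mul_left (commute_numberFun_sub _)) fun l => ?_
  simp only [Ring.lie_def, LinearMap.sub_apply, Module.End.mul_apply, onFst_opMinus_ketBasis,
    map_smul, numberFun_ketBasis_zero, fwdDiff]
  module

theorem lie_numberFun_opLower_add (h : ℕ → ℂ) : ⁅numberFun h, onFst opLower + onSnd opLower⁆
    = -(numberFun (fwdDiff 1 h) * (onFst opLower + onSnd opLower)) := by
  have hT := commute_opLower_add_opMinus_sub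
  have hΦ := commute_numberFun_sub h
  refine ext_of_commute_sub (commute_lie hΦ hT) ((commute_numberFun_sub _).mul_left hT).neg_left
    fun l => ?_
  cases l <;> simp only [Ring.lie_def, LinearMap.sub_apply, LinearMap.neg_apply,
    LinearMap.add_apply, Module.End.mul_apply, map_smul, numberFun_ketBasis_zero,
    onSnd_opLower_ketBasis_zero, onFst_opLower_ketBasis_zero, onFst_opLower_ketBasis_succ,
    add_zero, map_zero, fwdDiff] <;> module

theorem commute_numberFun_onSnd_opLower (h : ℕ → ℂ) :
    Commute (numberFun h) (onSnd opLower) := by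
  have lie_eq : ⁅onSnd opLower, onFst opMinus - onSnd opMinus⁆ = -1 := by
    rw [Ring.lie_def, mul_sub, sub_mul, (commute_onFst_onSnd _ _).eq, sub_sub_sub_cancel_left,
      ← neg_sub, ← Ring.lie_def, lie_map, lie_opLower_opMinus, map_one]
  rw [commute_iff_lie_eq]
  refine ext_of_commute_sub (commute_lie_of_commute (commute_numberFun_sub h) ?_)
    (Commute.zero_left _) fun l => ?_
  · rw [lie_eq]
    exact (Commute.one_right (numberFun h)).neg_right
  · simp only [Ring.lie_def, LinearMap.sub_apply, Module.End.mul_apply, numberFun_ketBasis_zero,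
      onSnd_opLower_ketBasis_zero, map_smul, map_zero, smul_zero, sub_zero, LinearMap.zero_apply]

/-- `h_k = ½ ∑_{m < k} f_m(x)`, the digamma-like sum of the poles of the generator. -/
def halfPoleSum (x : ℂ) (k : ℕ) : ℂ := ∑ m ∈ range k, 1 / 2 * pole m x

theorem fwdDiff_halfPoleSum (x : ℂ) : fwdDiff 1 (halfPoleSum x) = fun k => 1 / 2 * pole k x := by
  funext k
  rw [fwdDiff, halfPoleSum, sum_range_succ, halfPoleSum, add_sub_cancel_left]

theorem mul_half_pole {x : ℂ} {k : ℕ} (hx : x ≠ (k : ℂ) / 2) :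
    (2 * x - k) * (1 / 2 * pole k x) = 1 := by
  rw [show (2 * x - k) * (1 / 2 * pole k x) = (x - k / 2) * pole k x by ring]
  exact mul_inv_cancel₀ (sub_ne_zero.2 hx)

theorem isDigamma_numberFun {x : ℂ} (hx : ∀ m : ℕ, x ≠ (m : ℂ) / 2) :
    IsDigamma x (onFst opMinus) (onSnd opMinus) (onFst opLower) (onSnd opLower)
      (numberFun (halfPoleSum x)) (numberFun fun k => 1 / 2 * pole k x) where
  commute_sub := commute_numberFun_sub _
  commute_annihilation := commute_numberFun_onSnd_opLower _
  lie_add := by rw [lie_numberFun_opLower_add, fwdDiff_halfPoleSum]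
  lie_creation := by rw [lie_numberFun_onFst_opMinus, fwdDiff_halfPoleSum]
  mul_resolvent := by
    rw [← numberFun_const_sub, numberFun_mul, ← numberFun_one]
    exact congrArg numberFun (funext fun k => mul_half_pole (hx k))
  resolvent_mul := by
    rw [← numberFun_const_sub, numberFun_mul, mul_comm, ← numberFun_one]
    exact congrArg numberFun (funext fun k => mul_half_pole (hx k))

theorem isDigamma_exchange_numberFun {x : ℂ} (hx : ∀ m : ℕ, x ≠ (m : ℂ) / 2) :
    IsDigamma x (onSnd opMinus) (onFst opMinus) (onSnd opLower) (onFst opLower)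
      (exchange (numberFun (halfPoleSum x))) (exchange (numberFun fun k => 1 / 2 * pole k x)) := by
  simpa only [exchange_onFst, exchange_onSnd] using (isDigamma_numberFun hx).map exchange

end NumberFunction

section Generator

theorem neg_one_pow_sub {K : Type*} [CommRing K] {n k : ℕ} (h : k ≤ n) :
    (-1 : K) ^ (n - k) = (-1) ^ n * (-1) ^ k := by
  obtain ⟨d, rfl⟩ := Nat.exists_eq_add_of_le h
  rw [Nat.add_sub_cancel_left, pow_add, mul_right_comm, ← mul_pow, neg_one_mul, neg_neg, one_pow,
    one_mul]

theorem newtonCoeff_halfPoleSum_succ (x : ℂ) (l n : ℕ) :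
    newtonCoeff (halfPoleSum x) l (n + 1) = genLower (l + (n + 1)) l x := by
  rw [newtonCoeff, Function.iterate_succ_apply, fwdDiff_halfPoleSum, fwdDiff_iter_eq_sum_shift,
    genLower, sum_Ico_eq_sum_range, add_tsub_cancel_left, Nat.add_sub_cancel, mul_sum, mul_sum,
    ← Nat.choose_symm_add]
  refine sum_congr rfl fun k hk => ?_
  rw [add_tsub_cancel_left, zsmul_eq_mul, smul_eq_mul, mul_one]
  push_cast
  rw [neg_one_pow_sub (mem_range_succ_iff.1 hk)]
  ring

theorem halfPoleSum_sub (x : ℂ) {k l : ℕ} (h : k ≤ l) :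
    halfPoleSum x l - halfPoleSum x k = 1 / 2 * ∑ m ∈ Ico k l, pole m x := by
  rw [halfPoleSum, halfPoleSum, sum_Ico_eq_sub _ h, mul_sub, mul_sum, mul_sum]

theorem genBlock_apply (x : ℂ) {l j k m : ℕ} (h : k + m = l + j) :
    genBlock (l + j) x ⟨k, by omega⟩ ⟨l, by omega⟩
      = (if l ≤ k then newtonCoeff (halfPoleSum x) l (k - l) else 0)
        - (if j ≤ m then newtonCoeff (halfPoleSum x) j (m - j) else 0) := by
  simp only [genBlock, Matrix.of_apply, Fin.mk_lt_mk]
  rcases lt_trichotomy l k with hlt | rfl | hlt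
  · obtain ⟨n, rfl⟩ := Nat.exists_eq_add_of_lt hlt
    rw [if_pos hlt, if_pos hlt.le, if_neg (by omega), sub_zero,
      show l + n + 1 - l = n + 1 by omega, newtonCoeff_halfPoleSum_succ, add_assoc]
  · obtain rfl : m = j := by omega
    simp only [lt_irrefl, if_false, le_refl, if_true, Nat.sub_self, newtonCoeff_zero, genDiag,
      add_tsub_cancel_left]
    split_ifs with hl
    · linear_combination halfPoleSum_sub x (show l ≤ m by omega)
    · rw [add_tsub_cancel_right]
      linear_combination -halfPoleSum_sub x (show m ≤ l by omega)
  · obtain ⟨n, rfl⟩ := Nat.exists_eq_add_of_lt hlt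
    obtain rfl : m = j + (n + 1) := by omega
    rw [if_neg (by omega), if_pos hlt, if_neg (by omega), if_pos (by omega), zero_sub,
      add_tsub_cancel_left, add_tsub_cancel_left, newtonCoeff_halfPoleSum_succ,
      show k + n + 1 + j - k = j + (n + 1) by omega]

theorem numberFun_ketBasis_eq_sum_antidiagonal_add (h : ℕ → ℂ) (l j : ℕ) :
    numberFun h (ketBasis (l, j)) = ∑ n ∈ antidiagonal (l + j),
      (if l ≤ n.1 then newtonCoeff h l (n.1 - l) else 0) • ketBasis n := by
  rw [numberFun_ketBasis, Nat.sum_antidiagonal_eq_sum_range_succ_mk,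
    Nat.sum_antidiagonal_eq_sum_range_succ_mk, ← Nat.add_succ, sum_range_add,
    sum_eq_zero (s := range l), zero_add]
  · refine sum_congr rfl fun n _ => ?_
    rw [if_pos (Nat.le_add_right l n), Nat.add_sub_cancel_left, Nat.add_sub_add_left]
  · intro k hk
    rw [if_neg (not_le.2 (mem_range.1 hk)), zero_smul]

theorem exchange_numberFun_ketBasis (h : ℕ → ℂ) (l j : ℕ) :
    exchange (numberFun h) (ketBasis (l, j)) = ∑ n ∈ antidiagonal (l + j),
      (if j ≤ n.2 then newtonCoeff h j (n.2 - j) else 0) • ketBasis n := by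
  rw [exchange_ketBasis, numberFun_ketBasis_eq_sum_antidiagonal_add, map_sum, add_comm j l,
    ← Nat.sum_antidiagonal_swap]
  refine sum_congr rfl fun n _ => ?_
  rw [map_smul, comm_ketBasis]
  rfl

theorem blockSum_ketBasis (X : ∀ α : ℕ, Matrix (Fin (α + 1)) (Fin (α + 1)) ℂ) {a b α : ℕ}
    (h : a + b = α) : blockSum X (ketBasis (a, b))
      = ∑ k : Fin (α + 1), X α k ⟨a, by omega⟩ • ketBasis ((k : ℕ), α - k) := by
  subst h
  rw [blockSum, Module.Basis.constr_basis]

theorem gen_eq (x : ℂ) :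
    gen x = numberFun (halfPoleSum x) - exchange (numberFun (halfPoleSum x)) := by
  refine ketBasis_ext fun l j => ?_
  rw [LinearMap.sub_apply, numberFun_ketBasis_eq_sum_antidiagonal_add, exchange_numberFun_ketBasis,
    ← sum_sub_distrib, Nat.sum_antidiagonal_eq_sum_range_succ_mk, sum_range, gen,
    blockSum_ketBasis _ rfl]
  refine sum_congr rfl fun k _ => ?_
  rw [genBlock_apply x (Nat.add_sub_of_le (Nat.lt_succ_iff.1 k.2)), sub_smul]

end Generator

section RMatrix

theorem blockSum_mul (X Y : ∀ α : ℕ, Matrix (Fin (α + 1)) (Fin (α + 1)) ℂ) :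
    blockSum X * blockSum Y = blockSum fun α => X α * Y α := by
  refine ketBasis_ext fun a b => ?_
  rw [Module.End.mul_apply, blockSum_ketBasis Y rfl, map_sum, blockSum_ketBasis _ rfl]
  simp only [Matrix.mul_apply, sum_smul]
  rw [sum_comm]
  refine sum_congr rfl fun m _ => ?_
  rw [map_smul, blockSum_ketBasis X (Nat.add_sub_of_le (Nat.lt_succ_iff.1 m.2)), smul_sum]
  refine sum_congr rfl fun k _ => ?_
  rw [smul_smul, mul_comm]

theorem blockSum_one : blockSum (fun _ => 1) = 1 := by
  refine ketBasis_ext fun a b => ?_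
  rw [blockSum_ketBasis _ rfl]
  simp [Matrix.one_apply, ite_smul]

theorem blockSum_pow (X : ∀ α : ℕ, Matrix (Fin (α + 1)) (Fin (α + 1)) ℂ) (j : ℕ) :
    blockSum X ^ j = blockSum fun α => X α ^ j := by
  induction j with
  | zero => simp only [pow_zero, blockSum_one]
  | succ j ih => simp only [pow_succ, ih, blockSum_mul]

theorem smul_blockSum (c : ℂ) (X : ∀ α : ℕ, Matrix (Fin (α + 1)) (Fin (α + 1)) ℂ) :
    c • blockSum X = blockSum fun α => c • X α := by
  refine ketBasis_ext fun a b => ?_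
  simp only [LinearMap.smul_apply, blockSum_ketBasis _ rfl, smul_sum, smul_smul, Matrix.smul_apply,
    smul_eq_mul]

open scoped Matrix.Norms.Operator in
theorem hasSum_exp_apply {ι : Type*} [Fintype ι] [DecidableEq ι] (M : Matrix ι ι ℂ) (k l : ι) :
    HasSum (fun j : ℕ => (j.factorial : ℂ)⁻¹ * (M ^ j) k l) (NormedSpace.exp M k l) :=
  Pi.hasSum.1 (Pi.hasSum.1 (NormedSpace.exp_series_hasSum_exp' (𝕂 := ℂ) M) k) l

theorem isWeakExp_blockSum (M : ∀ α : ℕ, Matrix (Fin (α + 1)) (Fin (α + 1)) ℂ) :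
    IsWeakExp (blockSum fun α => NormedSpace.exp (M α)) (blockSum M) := by
  intro φ v
  have hv : v ∈ Submodule.span ℂ (Set.range ketBasis) := ketBasis.mem_span v
  induction hv using Submodule.span_induction with
  | mem _ hw =>
    obtain ⟨⟨a, b⟩, rfl⟩ := hw
    simp only [blockSum_pow, blockSum_ketBasis _ rfl, map_sum, mul_sum, map_smul, smul_eq_mul,
      ← mul_assoc]
    exact hasSum_sum fun k _ => (hasSum_exp_apply _ _ _).mul_right _
  | zero => simpa only [map_zero, mul_zero] using hasSum_zero
  | add u w _ _ hu hw => simpa only [map_add, mul_add] using hu.add hw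
  | smul c w _ hw => simpa only [map_smul, smul_eq_mul, mul_left_comm] using hw.mul_left c

theorem isWeakExp_rMatrix (p p' : ℂ) :
    IsWeakExp (rMatrix p p') ((p - p') • gen ((p + p') / 2)) := by
  rw [gen, smul_blockSum]
  exact isWeakExp_blockSum _

theorem isExpOf_rMatrix (p p' : ℂ) : IsExpOf (rMatrix p p') ((p - p') • gen ((p + p') / 2)) :=
  fun b c => isWeakExp_rMatrix p p' (ketBasis.coord b) (ketBasis c)

theorem genBlock_zero (x : ℂ) : genBlock 0 x = 0 := by
  ext k l
  obtain rfl : k = 0 := Fin.fin_one_eq_zero k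
  obtain rfl : l = 0 := Fin.fin_one_eq_zero l
  simp [genBlock, genDiag]

theorem rMatrix_vacuum (p p' : ℂ) : rMatrix p p' (ketBasis (0, 0)) = ketBasis (0, 0) := by
  rw [rMatrix, blockSum_ketBasis _ (add_zero 0)]
  simp [genBlock_zero]

theorem coord_vacuum_blockSum (X : ∀ α : ℕ, Matrix (Fin (α + 1)) (Fin (α + 1)) ℂ) {a b : ℕ}
    (h : a + b ≠ 0) : ketBasis.coord (0, 0) (blockSum X (ketBasis (a, b))) = 0 := by
  rw [blockSum_ketBasis X rfl, map_sum]
  refine sum_eq_zero fun k _ => ?_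
  rw [map_smul, Module.Basis.coord_apply, Module.Basis.repr_self,
    Finsupp.single_eq_of_ne (by simp only [ne_eq, Prod.mk.injEq]; omega), smul_zero]

theorem vacuum_rMatrix (p p' : ℂ) :
    ketBasis.coord (0, 0) ∘ₗ rMatrix p p' = ketBasis.coord (0, 0) := by
  refine ketBasis_ext fun a b => ?_
  rw [LinearMap.comp_apply]
  rcases eq_or_ne (a + b) 0 with h | h
  · obtain ⟨rfl, rfl⟩ := Nat.add_eq_zero_iff.1 h
    rw [rMatrix_vacuum]
  · rw [rMatrix, coord_vacuum_blockSum _ h, Module.Basis.coord_apply, Module.Basis.repr_self,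
      Finsupp.single_eq_of_ne (by simp only [ne_eq, Prod.mk.injEq]; omega)]

theorem onFst_opPlus_sub_onSnd_opPlus (p p' : ℂ) : onFst (opPlus p) - onSnd (opPlus p')
    = antisymmetricLowering ((p + p') / 2) (onFst opMinus) (onSnd opMinus) (onFst opLower)
        (onSnd opLower) - (p - p') • (onFst opLower + onSnd opLower) := by
  simp only [opPlus_eq, map_sub, map_mul, map_smul, antisymmetricLowering]
  module

theorem onFst_opMinus_mul_add_mul_onSnd_opMinus (p p' : ℂ) :
    onFst opMinus * onSnd (opZero p') + onFst (opZero p) * onSnd opMinus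
      = symmetricCreation ((p + p') / 2) (onFst opMinus) (onSnd opMinus) (onFst opLower)
          (onSnd opLower) - ((p - p') / 2) • (onFst opMinus - onSnd opMinus) := by
  simp only [opZero_eq, map_sub, map_mul, map_smul, map_one, symmetricCreation, mul_sub, sub_mul,
    mul_add, smul_mul_assoc, mul_smul_comm, one_mul, mul_one, mul_assoc,
    (commute_onFst_onSnd opLower opMinus).eq]
  module

/-- The Lax operator `L(p)` of a single site, as a matrix of operators on the auxiliary space. -/
def laxMatrix (p : ℂ) : Matrix (Fin 2) (Fin 2) (Module.End ℂ Aux) :=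
  !![opZero p, opPlus p; opMinus, opZero p]

theorem semiconjBy_rMatrix {p p' : ℂ} (h : ∀ m : ℕ, p + p' ≠ m) (i j : Fin 2) :
    SemiconjBy (rMatrix p p') (((laxMatrix p).map onFst * (laxMatrix p').map onSnd) i j)
      (((laxMatrix p').map onFst * (laxMatrix p).map onSnd) i j) := by
  have hx (m : ℕ) : (p + p') / 2 ≠ (m : ℂ) / 2 := fun e => h m (by linear_combination 2 * e)
  have h₁ := isDigamma_numberFun hx
  have h₂ := isDigamma_exchange_numberFun hx
  have hR : IsWeakExp (rMatrix p p') _ := gen_eq _ ▸ isWeakExp_rMatrix p p'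
  refine (isLaxTriple_op p).semiconjBy_fused (isLaxTriple_op p') commute_onFst_onSnd
    (h₁.semiconjBy_sub h₂ hR) ?_ ?_ i j
  · rw [onFst_opPlus_sub_onSnd_opPlus, onFst_opPlus_sub_onSnd_opPlus, add_comm p', ← neg_sub p]
    exact h₁.semiconjBy_antisymmetricLowering h₂ hR (commute_onFst_onSnd _ _)
      (commute_onFst_onSnd _ _) commute_opLower_add_opMinus_sub.symm
  · rw [onFst_opMinus_mul_add_mul_onSnd_opMinus, onFst_opMinus_mul_add_mul_onSnd_opMinus,
      add_comm p', ← neg_sub p]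
    exact h₁.semiconjBy_symmetricCreation h₂ hR (commute_onFst_onSnd _ _)

end RMatrix

section Chain

theorem lax_eq {n : ℕ} (k : Fin n) (p : ℂ) : lax k p = siteMatrix k (laxMatrix p) := by
  ext1 ν ν'
  simp only [lax, opTensor, atSite, siteMatrix_apply, Matrix.add_apply, Matrix.map_apply,
    Matrix.of_apply, sigmaZero, sigmaPlus, sigmaMinus, laxMatrix]
  split_ifs
  · generalize ν k = a, ν' k = b
    fin_cases a <;> fin_cases b <;> simp
  · simp

theorem laxFst_eq {n : ℕ} (k : Fin n) (p : ℂ) :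
    laxFst k p = siteMatrix k ((laxMatrix p).map onFst) := by
  rw [laxFst, lax_eq]
  exact siteMatrix_map onFst.toRingHom k _

theorem laxSnd_eq {n : ℕ} (k : Fin n) (p : ℂ) :
    laxSnd k p = siteMatrix k ((laxMatrix p).map onSnd) := by
  rw [laxSnd, lax_eq]
  exact siteMatrix_map onSnd.toRingHom k _

theorem onAux_eq (n : ℕ) (R : Module.End ℂ (Aux ⊗[ℂ] Aux)) :
    onAux (n := n) R = Matrix.diagonal fun _ => R := by
  rw [onAux, opTensor, ← Matrix.diagonal_one, Matrix.diagonal_map (zero_smul ℂ R)]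
  simp only [one_smul]

theorem semiconjBy_onAux_iff {n : ℕ} {R : Module.End ℂ (Aux ⊗[ℂ] Aux)}
    {X Y : Matrix (Config n) (Config n) (Module.End ℂ (Aux ⊗[ℂ] Aux))} :
    SemiconjBy (onAux R) X Y ↔ ∀ ν ν', SemiconjBy R (X ν ν') (Y ν ν') := by
  simp only [SemiconjBy, onAux_eq, ← Matrix.ext_iff, Matrix.diagonal_mul, Matrix.mul_diagonal]

theorem semiconjBy_onAux_rMatrix {p p' : ℂ} (h : ∀ m : ℕ, p + p' ≠ m) {n : ℕ} (k : Fin n) :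
    SemiconjBy (onAux (rMatrix p p')) (laxFst k p * laxSnd k p')
      (laxFst k p' * laxSnd k p) := by
  simp only [laxFst_eq, laxSnd_eq, siteMatrix_mul, semiconjBy_onAux_iff, siteMatrix_apply]
  intro ν ν'
  split_ifs
  · exact semiconjBy_rMatrix h _ _
  · exact SemiconjBy.zero_right _

theorem commute_laxFst_laxSnd {n : ℕ} {j k : Fin n} (hjk : j ≠ k) (p p' : ℂ) :
    Commute (laxFst j p) (laxSnd k p') := by
  rw [laxFst_eq, laxSnd_eq]
  exact commute_siteMatrix hjk fun _ _ _ _ => commute_onFst_onSnd _ _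

theorem monodromy_eq (n : ℕ) (p : ℂ) :
    monodromy n p = ((List.finRange n).map fun k => lax k p).prod := by
  rw [monodromy, List.ofFn_eq_map]

theorem monodromy_map_onFst (n : ℕ) (p : ℂ) :
    (monodromy n p).map onFst = ((List.finRange n).map fun k => laxFst k p).prod := by
  rw [monodromy_eq]
  exact (map_list_prod onFst.mapMatrix _).trans (by rw [List.map_map]; rfl)

theorem monodromy_map_onSnd (n : ℕ) (p : ℂ) :
    (monodromy n p).map onSnd = ((List.finRange n).map fun k => laxSnd k p).prod := by
  rw [monodromy_eq]
  exact (map_list_prod onSnd.mapMatrix _).trans (by rw [List.map_map]; rfl)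

theorem coord_vacuum_onFst_mul_onSnd (A B : Module.End ℂ Aux) :
    ketBasis.coord (0, 0) ((onFst A * onSnd B) (ketBasis (0, 0)))
      = A (ket 0) 0 * B (ket 0) 0 := by
  rw [Module.End.mul_apply, onSnd_ketBasis, onFst_tmul, Module.Basis.coord_apply, ketBasis,
    Module.Basis.tensorProduct_repr_tmul_apply]
  simp [mul_comm]

theorem transfer_mul_apply (n : ℕ) (p p' : ℂ) (ν ν' : Config n) :
    (transfer n p * transfer n p') ν ν' = ketBasis.coord (0, 0)
      (((List.finRange n).map fun k => laxFst k p * laxSnd k p').prod ν ν' (ketBasis (0, 0))) := by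
  rw [← list_prod_mul_prod (fun _ _ hij => commute_laxFst_laxSnd hij p p') (List.nodup_finRange n),
    ← monodromy_map_onFst, ← monodromy_map_onSnd, Matrix.mul_apply, Matrix.mul_apply,
    LinearMap.sum_apply, map_sum]
  exact sum_congr rfl fun μ _ => (coord_vacuum_onFst_mul_onSnd _ _).symm

theorem transfer_mul_comm_of_ne {p p' : ℂ} (h : ∀ m : ℕ, p + p' ≠ m) (n : ℕ) :
    transfer n p * transfer n p' = transfer n p' * transfer n p := by
  ext ν ν'
  have train := semiconjBy_onAux_iff.1
    (semiconjBy_list_prod (semiconjBy_onAux_rMatrix h) (List.finRange n)) ν ν'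
  have sandwich := congrArg (ketBasis.coord (0, 0)) (LinearMap.congr_fun train (ketBasis (0, 0)))
  rwa [Module.End.mul_apply, Module.End.mul_apply, rMatrix_vacuum, ← LinearMap.comp_apply,
    vacuum_rMatrix, ← transfer_mul_apply, ← transfer_mul_apply] at sandwich

/-- The slope of the Lax operator, which is affine in `p`. -/
def laxSlope {n : ℕ} (k : Fin n) : Matrix (Config n) (Config n) (Module.End ℂ Aux) :=
  opTensor (atSite k sigmaZero) 1 + opTensor (atSite k sigmaPlus) ((-2 : ℂ) • opLower)

theorem lax_eq_add_smul {n : ℕ} (k : Fin n) (p : ℂ) :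
    lax k p = lax k 0 + p • laxSlope k := by
  ext1 ν ν'
  simp only [lax, laxSlope, opTensor, opZero_eq p, opPlus_eq p, opZero_eq 0, opPlus_eq 0,
    Matrix.add_apply, Matrix.smul_apply, Matrix.map_apply]
  module

theorem continuous_transfer (n : ℕ) : Continuous (transfer n) := by
  refine continuous_matrix fun ν ν' => ?_
  refine (continuous_list_prod_add_smul (fun k => lax k 0) laxSlope (List.finRange n)
    (Finsupp.lapply 0 ∘ₗ LinearMap.applyₗ (ket 0)
      ∘ₗ Matrix.entryLinearMap ℂ _ ν ν')).congr fun p => ?_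
  simp only [← lax_eq_add_smul, ← monodromy_eq]
  rfl

theorem transfer_mul_comm (n : ℕ) (p p' : ℂ) :
    transfer n p * transfer n p' = transfer n p' * transfer n p := by
  have dense_generic : Dense (Set.range fun m : ℕ => (m : ℂ) - p)ᶜ :=
    (Set.countable_range _).dense_compl ℂ
  have hc := continuous_transfer n
  refine congrFun (Continuous.ext_on dense_generic (continuous_const.matrix_mul hc)
    (hc.matrix_mul continuous_const) fun q hq => ?_) p'
  exact transfer_mul_comm_of_ne (fun m hm => hq ⟨m, sub_eq_of_eq_add' hm.symm⟩) n

end Chain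

end AuxiliarySpace

end ExteriorIntegrability

end

theorem theorem1 :
    (∀ x y : ℂ, (∀ m : ℕ, x ≠ (m : ℂ) / 2) →
      -- `Ř(x + y/2, x - y/2) = exp (y H(x))`
      ExteriorIntegrability.IsExpOf
        (ExteriorIntegrability.rMatrix (x + y / 2) (x - y / 2))
        (y • ExteriorIntegrability.gen x) ∧
      -- the RLL relation at every site of a chain of any length
      (∀ (n : ℕ) (k : Fin n),
        ExteriorIntegrability.onAux (ExteriorIntegrability.rMatrix (x + y / 2) (x - y / 2))
            * ExteriorIntegrability.laxFst k (x + y / 2)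
            * ExteriorIntegrability.laxSnd k (x - y / 2)
          = ExteriorIntegrability.laxFst k (x - y / 2)
            * ExteriorIntegrability.laxSnd k (x + y / 2)
            * ExteriorIntegrability.onAux
                (ExteriorIntegrability.rMatrix (x + y / 2) (x - y / 2))) ∧
      -- `Ř |0,0⟩ = |0,0⟩` and `⟨0,0| Ř = ⟨0,0|`
      ExteriorIntegrability.rMatrix (x + y / 2) (x - y / 2)
          (ExteriorIntegrability.ketBasis (0, 0)) = ExteriorIntegrability.ketBasis (0, 0) ∧
      ExteriorIntegrability.ketBasis.coord (0, 0)
          ∘ₗ ExteriorIntegrability.rMatrix (x + y / 2) (x - y / 2)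
        = ExteriorIntegrability.ketBasis.coord (0, 0)) ∧
    -- the transfer operators commute
    (∀ (n : ℕ) (p p' : ℂ),
      ExteriorIntegrability.transfer n p * ExteriorIntegrability.transfer n p'
        = ExteriorIntegrability.transfer n p' * ExteriorIntegrability.transfer n p) := by
  refine ⟨fun x y hx => ⟨?_, fun n k => ?_, ExteriorIntegrability.rMatrix_vacuum _ _,
    ExteriorIntegrability.vacuum_rMatrix _ _⟩, ExteriorIntegrability.transfer_mul_comm⟩
  · have hexp := ExteriorIntegrability.isExpOf_rMatrix (x + y / 2) (x - y / 2)
    rwa [show x + y / 2 - (x - y / 2) = y by ring,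
      show (x + y / 2 + (x - y / 2)) / 2 = x by ring] at hexp
  · have hsum (m : ℕ) : x + y / 2 + (x - y / 2) ≠ m := fun hm =>
      hx m (by linear_combination hm / 2)
    rw [mul_assoc]
    exact (ExteriorIntegrability.semiconjBy_onAux_rMatrix hsum k).eq
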